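/- For an integer $n\ge 2$, let $G_{\mathbb{Z}/n\mathbb{Z}}$ be the unitary Cayley graph of $\mathbb{Z}/n\mathbb{Z}$, that is, the graph with vertex set $\mathbb{Z}/n\mathbb{Z}$ in which $x$ and $y$ are adjacent if and only if $x-y$ is a unit of $\mathbb{Z}/n\mathbb{Z}$. A finite $r$-regular graph is called Ramanujan if every eigenvalue $\lambda$ of its adjacency matrix with $\lambda\neq\pm r$ satisfies $|\lambda|\le 2\sqrt{r-1}$. Then, for every integer $n\ge 2$, the graph $G_{\mathbb{Z}/n\mathbb{Z}}$ is Ramanujan if and only if one of the following holds: (a) $n=2^{\alpha}$ for some integer $\alpha\ge 1$; (b) $n=p^{\alpha}$ for some odd prime $p$ and some $\alpha\in\{1,2\}$; (c) $n=4pq$ for some primes $p,q$ with $3\le p<q\le 2p-3$; (d) $n=pq$ or $n=2pq$ for some primes $p,q$ with $3\le p<q\le 4p-5$; (e) $n=2p^2$ or $n=4p^2$ for some odd prime $p$, or $n=2^{\alpha}p$ for some odd prime $p$ and some integer $\alpha\ge 1$ with $p>2^{\alpha-3}+1$ (where $2^{\alpha-3}$ is a rational number when $\alpha<3$). -/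

import Mathlib

/-- The unitary Cayley graph `Cay(R, Rˣ)` of a commutative ring `R`: the Cayley graph of the additive
group of `R` whose connection set is the set of units of `R`. -/
def unitaryCayleyGraph (R : Type*) [CommRing R] : SimpleGraph R :=
  SimpleGraph.addCayley {u : R | IsUnit u}

/-- In a nontrivial ring, `x` and `y` are adjacent if and only if `x - y` is a unit. -/
theorem unitaryCayleyGraph_adj {R : Type*} [CommRing R] [Nontrivial R] (x y : R) :
    (unitaryCayleyGraph R).Adj x y ↔ IsUnit (x - y) := by
  unfold unitaryCayleyGraph
  rw [SimpleGraph.addCayley_adj']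
  constructor
  · rintro ⟨-, g, hg, h | h⟩
    · have : x - y = -g := by rw [← h]; ring
      rw [this]; exact IsUnit.neg hg
    · have : x - y = g := by rw [h]; ring
      rw [this]; exact hg
  · intro h
    refine ⟨?_, x - y, h, Or.inr (by ring)⟩
    rintro rfl
    rw [sub_self] at h
    exact not_isUnit_zero h

open Classical in
/-- A finite graph is Ramanujan if it is `r`-regular for some `r` and every eigenvalue of its
adjacency matrix other than `r` and `-r` is at most `2 √(r - 1)` in absolute value.
The adjacency matrix is real symmetric, so all its eigenvalues are real. -/
def IsRamanujan {V : Type*} [Fintype V] (G : SimpleGraph V) : Prop :=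
  ∃ r : ℕ, G.IsRegularOfDegree r ∧
    ∀ μ : ℝ, Module.End.HasEigenvalue (Matrix.toLin' (G.adjMatrix ℝ)) μ →
      μ ≠ r → μ ≠ -r → |μ| ≤ 2 * √((r : ℝ) - 1)

/-! The adjacency operator sends `f` to the sum of `f (x + u)` over units `u`. For a prime `q ∣ n`
put `N = φ(n) / (q - 1)`. The function `q · [q ∣ x] - 1` is an eigenvector with eigenvalue `-N`.
Conversely, if an eigenvector is not periodic under the prime-to-`q` part of `n`, its eigenvalue is
at most `N` in absolute value. An eigenvector with nonzero eigenvalue is also periodic under twice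
the odd part of `n`. So if `|μ|` exceeds `N` for every odd `q`, these periods generate `2`; all
units are `1` modulo multiples of `2`, whence `μ = ±φ(n)`.

Thus only the values `N` for odd `q` matter, and `N ≤ 2√(φ(n) - 1)` amounts to `φ(n) < 4(q - 1)²`
(`isRamanujan_unitaryCayleyGraph_zmod_iff`). This is strictest at the smallest odd prime factor `p`;
cancelling `p - 1` leaves few shapes for `n` (`totient_lt_cases`). -/

open Finset

/-! ### Sums over units and their eigenvectors -/

section UnitSums

variable {R S F : Type*} [CommRing R] [Fintype R] [CommRing S] [Field F]

/-- If the image of `π₁ × π₂ : R → S × F` contains `0 × F`, a function on `F` of sum zero sums to zero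
over the elements of `R` whose image in `S` is a unit. -/
theorem sum_isUnit_fiber_eq_zero [Fintype F] (π₁ : R →+* S) (π₂ : R →+* F)
    (hs : ∀ c, ∃ s, π₁ s = 0 ∧ π₂ s = c)
    [DecidablePred fun x => IsUnit (π₁ x)] (g : F → ℝ) (hg : ∑ c, g c = 0) :
    ∑ y with IsUnit (π₁ y), g (π₂ y) = 0 := by
  choose s hs1 hs2 using hs
  have shift : ∀ c, ∑ y with IsUnit (π₁ y), g (π₂ y) = ∑ y with IsUnit (π₁ y), g (π₂ y + c) := by
    intro c
    rw [Finset.sum_filter, Finset.sum_filter, ← Equiv.sum_comp (Equiv.addRight (s c))]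
    simp [hs1, hs2]
  -- The sum is unchanged by every shift `c`, so `|F|` times it is a double sum whose inner sum over
  -- `c` vanishes.
  have key : ∑ c : F, ∑ y with IsUnit (π₁ y), g (π₂ y) = 0 := by
    rw [Finset.sum_congr rfl fun c _ => shift c, Finset.sum_comm]
    refine Finset.sum_eq_zero fun y _ => ?_
    rw [← hg]
    exact Equiv.sum_comp (Equiv.addLeft (π₂ y)) g
  rw [Finset.sum_const, nsmul_eq_mul, mul_eq_zero] at key
  refine key.resolve_left ?_
  simp

theorem sum_isUnit_eq_sub (π₁ : R →+* S) (π₂ : R →+* F)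
    (hu : ∀ x, IsUnit x ↔ IsUnit (π₁ x) ∧ π₂ x ≠ 0)
    [DecidablePred fun x : R => IsUnit x] [DecidablePred fun x => IsUnit (π₁ x)]
    [DecidablePred fun x => IsUnit (π₁ x) ∧ π₂ x = 0] (h : R → ℝ) :
    ∑ y with IsUnit y, h y =
      ∑ y with IsUnit (π₁ y), h y - ∑ y with IsUnit (π₁ y) ∧ π₂ y = 0, h y := by
  rw [eq_sub_iff_add_eq, Finset.sum_filter, Finset.sum_filter, Finset.sum_filter,
    ← Finset.sum_add_distrib]
  refine Finset.sum_congr rfl fun y _ => ?_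
  by_cases h1 : IsUnit (π₁ y) <;> by_cases h2 : π₂ y = 0 <;> simp [hu, h1, h2]

theorem sum_ite_eq_zero_mul_card_sub_one [Fintype F] [DecidableEq F] :
    ∑ c : F, (if c = 0 then (Fintype.card F : ℝ) - 1 else -1) = 0 := by
  have : ∀ c : F, (if c = 0 then (Fintype.card F : ℝ) - 1 else -1)
      = (if c = 0 then (Fintype.card F : ℝ) else 0) - 1 := by
    intro c; split_ifs <;> ring
  simp [this]

theorem card_isUnit_eq [Fintype F] (π₁ : R →+* S) (π₂ : R →+* F)
    (hs : ∀ c, ∃ s, π₁ s = 0 ∧ π₂ s = c)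
    (hu : ∀ x, IsUnit x ↔ IsUnit (π₁ x) ∧ π₂ x ≠ 0)
    [DecidablePred fun x : R => IsUnit x]
    [DecidablePred fun x => IsUnit (π₁ x) ∧ π₂ x = 0] :
    (#{y : R | IsUnit y} : ℝ) =
      (Fintype.card F - 1) * #{y : R | IsUnit (π₁ y) ∧ π₂ y = 0} := by
  classical
  have h := sum_isUnit_fiber_eq_zero π₁ π₂ hs _ sum_ite_eq_zero_mul_card_sub_one
  have h2 := sum_isUnit_eq_sub π₁ π₂ hu
    fun y => if π₂ y = 0 then (Fintype.card F : ℝ) - 1 else -1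
  rw [h] at h2
  have e1 : ∑ y with IsUnit y, (if π₂ y = 0 then (Fintype.card F : ℝ) - 1 else -1)
      = ∑ y : R with IsUnit y, (-1 : ℝ) :=
    Finset.sum_congr rfl fun y hy => if_neg ((hu y).1 (Finset.mem_filter.1 hy).2).2
  have e2 : ∑ y with IsUnit (π₁ y) ∧ π₂ y = 0, (if π₂ y = 0 then (Fintype.card F : ℝ) - 1 else -1)
      = ∑ y with IsUnit (π₁ y) ∧ π₂ y = 0, ((Fintype.card F : ℝ) - 1) :=
    Finset.sum_congr rfl fun y hy => if_pos (Finset.mem_filter.1 hy).2.2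
  rw [e1, e2, Finset.sum_const, Finset.sum_const, nsmul_eq_mul, nsmul_eq_mul] at h2
  linarith

/-- The function `x ↦ |F| · [π₂ x = 0] - 1` is an eigenvector of the sum over units. -/
theorem sum_isUnit_residue_indicator [Fintype F] [DecidableEq F] (π₁ : R →+* S) (π₂ : R →+* F)
    (hs : ∀ c, ∃ s, π₁ s = 0 ∧ π₂ s = c) (hu : ∀ x, IsUnit x ↔ IsUnit (π₁ x) ∧ π₂ x ≠ 0)
    [DecidablePred fun x : R => IsUnit x]
    [DecidablePred fun x => IsUnit (π₁ x) ∧ π₂ x = 0] (x : R) :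
    ∑ y with IsUnit y, (if π₂ (x + y) = 0 then (Fintype.card F : ℝ) - 1 else -1) =
      -(#{y : R | IsUnit (π₁ y) ∧ π₂ y = 0} : ℝ) *
        (if π₂ x = 0 then (Fintype.card F : ℝ) - 1 else -1) := by
  classical
  have h := sum_isUnit_fiber_eq_zero π₁ π₂ hs
    (fun c => if π₂ x + c = 0 then (Fintype.card F : ℝ) - 1 else -1) (by
      rw [← sum_ite_eq_zero_mul_card_sub_one (F := F)]
      exact Equiv.sum_comp (Equiv.addLeft (π₂ x))
        (fun c => if c = 0 then (Fintype.card F : ℝ) - 1 else -1))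
  simp only [map_add]
  rw [sum_isUnit_eq_sub π₁ π₂ hu, h, zero_sub, neg_mul, neg_inj, ← nsmul_eq_mul,
    ← Finset.sum_const]
  exact Finset.sum_congr rfl fun y hy => by rw [(Finset.mem_filter.1 hy).2.2, add_zero]

/-- An eigenvector of the sum over units is invariant under translation by the kernel of `π₁`,
unless its eigenvalue is small. -/
theorem abs_le_or_periodic_of_sum_isUnit (π₁ : R →+* S) (π₂ : R →+* F)
    (hu : ∀ x, IsUnit x ↔ IsUnit (π₁ x) ∧ π₂ x ≠ 0)
    [DecidablePred fun x : R => IsUnit x]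
    [DecidablePred fun x => IsUnit (π₁ x) ∧ π₂ x = 0] {f : R → ℝ} {μ : ℝ}
    (hf : ∀ x, ∑ y with IsUnit y, f (x + y) = μ * f x) :
    |μ| ≤ #{y : R | IsUnit (π₁ y) ∧ π₂ y = 0} ∨ ∀ s, π₁ s = 0 → ∀ x, f (x + s) = f x := by
  classical
  rw [or_iff_not_imp_right]
  intro hper
  push Not at hper
  obtain ⟨s, hs, x₀, hx₀⟩ := hper
  -- The difference of `f` along `s` sums to zero over the `y` with `π₁ y` a unit, since translation
  -- by `s` permutes them. Only the terms with `π₂ y = 0` survive; the bound follows where the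
  -- difference is largest in absolute value.
  have hg : ∀ x, μ * (f (x + s) - f x) =
      -∑ y with IsUnit (π₁ y) ∧ π₂ y = 0, (f (x + y + s) - f (x + y)) := by
    intro x
    have h0 : ∑ y with IsUnit (π₁ y), (f (x + y + s) - f (x + y)) = 0 := by
      rw [Finset.sum_sub_distrib, sub_eq_zero, eq_comm, Finset.sum_filter, Finset.sum_filter,
        ← Equiv.sum_comp (Equiv.addRight s)]
      simp [hs, add_assoc]
    have h1 := sum_isUnit_eq_sub π₁ π₂ hu fun y => f (x + y + s) - f (x + y)
    rw [h0, zero_sub] at h1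
    rw [← h1, mul_sub, ← hf, ← hf, ← Finset.sum_sub_distrib]
    exact Finset.sum_congr rfl fun y _ => by rw [add_right_comm]
  obtain ⟨z, -, hz⟩ := Finset.exists_max_image (Finset.univ : Finset R)
    (fun x => |f (x + s) - f x|) ⟨x₀, Finset.mem_univ _⟩
  have hpos : 0 < |f (z + s) - f z| :=
    (abs_pos.2 (sub_ne_zero.2 hx₀)).trans_le (hz x₀ (Finset.mem_univ _))
  refine le_of_mul_le_mul_right ?_ hpos
  rw [← abs_mul, hg, abs_neg, ← nsmul_eq_mul, ← Finset.sum_const]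
  exact (Finset.abs_sum_le_sum_abs _ _).trans
    (Finset.sum_le_sum fun y _ => hz (z + y) (Finset.mem_univ _))

/-- An eigenvector of the sum over units with nonzero eigenvalue is invariant under each
translation that preserves the set of units. -/
theorem eq_zero_or_periodic_of_sum_isUnit [DecidablePred fun x : R => IsUnit x] {f : R → ℝ} {μ : ℝ}
    (hf : ∀ x, ∑ y with IsUnit y, f (x + y) = μ * f x) {s : R}
    (hs : ∀ x, IsUnit (x + s) ↔ IsUnit x) :
    μ = 0 ∨ ∀ x, f (x + s) = f x := by
  rw [or_iff_not_imp_left]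
  intro hμ x
  refine mul_left_cancel₀ hμ ?_
  rw [← hf, ← hf, eq_comm, Finset.sum_filter, Finset.sum_filter,
    ← Equiv.sum_comp (Equiv.addRight s)]
  simp [hs, add_assoc, add_comm s]

/-- If all units are congruent to `1` modulo `2`, an eigenvector of the sum over units that is
invariant under translation by `2` has eigenvalue plus or minus the number of units. -/
theorem sq_eq_sq_of_periodic_two [DecidablePred fun x : R => IsUnit x] {f : R → ℝ} {μ : ℝ}
    (hf : ∀ x, ∑ y with IsUnit y, f (x + y) = μ * f x) (hf0 : f ≠ 0)
    (hone : ∀ y : R, IsUnit y → ∃ v, y = 1 + v ∧ ∀ x, f (x + v) = f x)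
    (htwo : ∀ x, f (x + 2) = f x) :
    μ ^ 2 = (#{y : R | IsUnit y} : ℝ) ^ 2 := by
  have h1 : ∀ x, (#{y : R | IsUnit y} : ℝ) * f (x + 1) = μ * f x := by
    intro x
    rw [← hf, ← nsmul_eq_mul, ← Finset.sum_const]
    refine Finset.sum_congr rfl fun y hy => ?_
    obtain ⟨v, rfl, hv⟩ := hone y (Finset.mem_filter.1 hy).2
    rw [← add_assoc, hv]
  obtain ⟨x, hx⟩ := Function.ne_iff.1 hf0
  refine mul_right_cancel₀ (b := f x) hx ?_
  have h2 := h1 (x + 1)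
  rw [add_assoc, one_add_one_eq_two, htwo] at h2
  rw [sq, mul_assoc, ← h1, mul_left_comm, ← h2, ← mul_assoc, sq]

end UnitSums

/-! ### Reduction modulo a prime and its complementary factor -/

namespace ZMod

theorem isUnit_iff_castHom {n b q t : ℕ} [NeZero n] (hn : q ^ b * t = n) (hb : b ≠ 0)
    (hq : q.Prime) (htn : t ∣ n) (hqn : q ∣ n) (x : ZMod n) :
    IsUnit x ↔ IsUnit (castHom htn (ZMod t) x) ∧ castHom hqn (ZMod q) x ≠ 0 := by
  obtain ⟨k, rfl⟩ : ∃ k : ℕ, (k : ZMod n) = x := ⟨x.val, natCast_zmod_val x⟩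
  rw [map_natCast, map_natCast, isUnit_iff_coprime, isUnit_iff_coprime, Ne,
    natCast_eq_zero_iff, ← hq.coprime_iff_not_dvd, ← hn, Nat.coprime_mul_iff_right,
    Nat.coprime_pow_right_iff (Nat.pos_of_ne_zero hb), Nat.coprime_comm (n := q), and_comm]

theorem exists_castHom_eq {n q t : ℕ} [NeZero q] (hqt : q.Coprime t) (htn : t ∣ n) (hqn : q ∣ n)
    (c : ZMod q) :
    ∃ s : ZMod n, castHom htn (ZMod t) s = 0 ∧ castHom hqn (ZMod q) s = c := by
  have ht := (isUnit_iff_coprime t q).2 hqt.symm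
  obtain ⟨d, hd⟩ := ht.exists_right_inv
  refine ⟨(((c * d).val : ℕ) : ZMod n) * (t : ZMod n), ?_, ?_⟩
  · rw [map_mul, map_natCast _ t, natCast_self, mul_zero]
  · rw [map_mul, map_natCast, map_natCast, natCast_zmod_val, mul_assoc, mul_comm d, hd, mul_one]

end ZMod

/-! ### The spectrum of the graph and the totient criterion -/

section Spectrum

theorem Nat.Prime.three_le_of_odd {p : ℕ} (hp : p.Prime) (ho : Odd p) : 3 ≤ p := by
  have := hp.two_le
  obtain ⟨k, rfl⟩ := ho
  omega

theorem adjMatrix_unitaryCayleyGraph_apply {R : Type*} [CommRing R] [Nontrivial R] [Fintype R]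
    [DecidableEq R] [DecidableRel (unitaryCayleyGraph R).Adj] [DecidablePred fun x : R => IsUnit x]
    (f : R → ℝ) (x : R) :
    Matrix.toLin' ((unitaryCayleyGraph R).adjMatrix ℝ) f x = ∑ u with IsUnit u, f (x + u) := by
  rw [Matrix.toLin'_apply, SimpleGraph.adjMatrix_mulVec_apply]
  refine Finset.sum_nbij' (fun y => y - x) (fun u => x + u) ?_ ?_ ?_ ?_ ?_
  · intro y hy
    simpa [unitaryCayleyGraph_adj, ← IsUnit.neg_iff (x - y)] using hy
  · intro u hu
    simpa [unitaryCayleyGraph_adj] using hu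
  · simp
  · simp
  · simp

theorem hasEigenvalue_unitaryCayleyGraph_iff {R : Type*} [CommRing R] [Nontrivial R] [Fintype R]
    [DecidableEq R] [DecidableRel (unitaryCayleyGraph R).Adj] [DecidablePred fun x : R => IsUnit x]
    (μ : ℝ) :
    Module.End.HasEigenvalue (Matrix.toLin' ((unitaryCayleyGraph R).adjMatrix ℝ)) μ ↔
      ∃ f : R → ℝ, f ≠ 0 ∧ ∀ x, ∑ y with IsUnit y, f (x + y) = μ * f x := by
  have key : ∀ f : R → ℝ, Module.End.HasEigenvector
      (Matrix.toLin' ((unitaryCayleyGraph R).adjMatrix ℝ)) μ f ↔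
        f ≠ 0 ∧ ∀ x, ∑ y with IsUnit y, f (x + y) = μ * f x := by
    intro f
    rw [Module.End.hasEigenvector_iff, Module.End.mem_eigenspace_iff, funext_iff, and_comm]
    simp only [adjMatrix_unitaryCayleyGraph_apply, Pi.smul_apply, smul_eq_mul]
  constructor
  · intro h
    obtain ⟨f, hf⟩ := h.exists_hasEigenvector
    exact ⟨f, (key f).1 hf⟩
  · rintro ⟨f, hf⟩
    exact Module.End.hasEigenvalue_of_hasEigenvector ((key f).2 hf)

theorem degree_unitaryCayleyGraph {R : Type*} [CommRing R] [Nontrivial R] [Fintype R] (x : R)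
    [Fintype ((unitaryCayleyGraph R).neighborSet x)] [DecidablePred fun x : R => IsUnit x] :
    (unitaryCayleyGraph R).degree x = #{u : R | IsUnit u} := by
  refine Finset.card_nbij' (fun y => y - x) (fun u => x + u) ?_ ?_ ?_ ?_
  · intro y hy
    simpa [unitaryCayleyGraph_adj, ← IsUnit.neg_iff (x - y)] using hy
  · intro u hu
    simpa [unitaryCayleyGraph_adj] using hu
  · intro; simp
  · intro; simp

theorem isRamanujan_unitaryCayleyGraph_iff {R : Type*} [CommRing R] [Nontrivial R] [Fintype R]
    [DecidablePred fun x : R => IsUnit x] {r : ℕ} (hr : #{u : R | IsUnit u} = r) :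
    IsRamanujan (unitaryCayleyGraph R) ↔ ∀ (μ : ℝ) (f : R → ℝ), f ≠ 0 →
      (∀ x, ∑ y with IsUnit y, f (x + y) = μ * f x) → μ ≠ r → μ ≠ -r →
        |μ| ≤ 2 * √((r : ℝ) - 1) := by
  classical
  subst hr
  constructor
  · rintro ⟨r, hr, hμ⟩ μ f hf0 hf
    have hr' : #{u : R | IsUnit u} = r := by rw [← hr 0, degree_unitaryCayleyGraph]
    rw [hr']
    exact hμ μ ((hasEigenvalue_unitaryCayleyGraph_iff μ).2 ⟨f, hf0, hf⟩)
  · refine fun h => ⟨_, fun v => degree_unitaryCayleyGraph v, fun μ hμ => ?_⟩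
    obtain ⟨f, hf0, hf⟩ := (hasEigenvalue_unitaryCayleyGraph_iff μ).1 hμ
    exact h μ f hf0 hf

theorem ZMod.card_isUnit (n : ℕ) [NeZero n] [DecidablePred fun x : ZMod n => IsUnit x] :
    #{u : ZMod n | IsUnit u} = n.totient := by
  rw [← ZMod.card_units_eq_totient, ← Fintype.card_subtype]
  exact (Fintype.card_congr (Equiv.ofBijective
    (fun u : (ZMod n)ˣ => (⟨(u : ZMod n), u.isUnit⟩ : {x : ZMod n // IsUnit x}))
    ⟨fun u v h => Units.ext (congrArg Subtype.val h), fun ⟨_, u, hu⟩ => ⟨u, Subtype.ext hu⟩⟩)).symm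

/-- A subgroup of `ZMod n` contains `2` once it contains the odd part of `n` doubled and, for each
odd prime `q` dividing `n`, the prime-to-`q` part of `n`. -/
theorem ZMod.two_mem_of_ordCompl_mem {n : ℕ} (hn : n ≠ 0) (P : AddSubgroup (ZMod n))
    (h2 : ((2 * ordCompl[2] n : ℕ) : ZMod n) ∈ P)
    (hq : ∀ q, q.Prime → Odd q → q ∣ n → ((ordCompl[q] n : ℕ) : ZMod n) ∈ P) : (2 : ZMod n) ∈ P := by
  obtain ⟨g, hg⟩ := Int.subgroup_cyclic (P.comap (Int.castAddHom (ZMod n)))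
  have key : ∀ k : ℕ, (k : ZMod n) ∈ P ↔ g.natAbs ∣ k := by
    intro k
    rw [← Int.natCast_dvd_natCast, Int.natAbs_dvd, ← Int.mem_zmultiples_iff,
      AddSubgroup.zmultiples_eq_closure, ← hg]
    simp
  have hgn : g.natAbs ∣ n := (key n).1 (by simp)
  rw [key] at h2
  -- `g` generates the preimage of `P` in the integers. No odd prime `q` divides it, because it
  -- divides the prime-to-`q` part of `n`.
  have hcop : g.natAbs.Coprime (ordCompl[2] n) := by
    refine Nat.coprime_of_dvd fun q hqp hqg hq2 => ?_
    have hodd : Odd q := hqp.odd_of_ne_two fun h =>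
      Nat.not_dvd_ordCompl Nat.prime_two hn (h ▸ hq2)
    exact Nat.not_dvd_ordCompl hqp hn
      (hqg.trans ((key _).1 (hq q hqp hodd (hqg.trans hgn))))
  exact_mod_cast (key 2).2 (hcop.dvd_of_dvd_mul_right h2)

theorem ZMod.exists_eq_one_add_two_mul {n : ℕ} [NeZero n] {y : ZMod n} (hy : IsUnit y) :
    ∃ k : ℕ, y = 1 + k * 2 := by
  rcases Nat.even_or_odd n with hn | hn
  · obtain ⟨k, rfl⟩ : ∃ k : ℕ, (k : ZMod n) = y := ⟨y.val, natCast_zmod_val y⟩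
    rw [isUnit_iff_coprime] at hy
    obtain ⟨m, rfl⟩ : Odd k := Nat.coprime_two_right.1 (hy.coprime_dvd_right hn.two_dvd)
    exact ⟨m, by push_cast; ring⟩
  · have h2 : IsUnit ((2 : ℕ) : ZMod n) :=
      (isUnit_iff_coprime 2 n).2 (Nat.coprime_two_left.2 hn)
    obtain ⟨d, hd⟩ := h2.exists_left_inv
    refine ⟨((y - 1) * d).val, ?_⟩
    rw [natCast_zmod_val, mul_assoc]
    push_cast at hd
    rw [hd]; ring

/-- Every prime factor of `n` divides twice its odd part, so the shift does not affect coprimality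
to `n`. -/
theorem ZMod.isUnit_add_two_mul_ordCompl {n : ℕ} [NeZero n] (x : ZMod n) :
    IsUnit (x + ((2 * ordCompl[2] n : ℕ) : ZMod n)) ↔ IsUnit x := by
  obtain ⟨k, rfl⟩ : ∃ k : ℕ, (k : ZMod n) = x := ⟨x.val, natCast_zmod_val x⟩
  rw [← Nat.cast_add, isUnit_iff_coprime, isUnit_iff_coprime,
    ← Nat.ordProj_mul_ordCompl_eq_self n 2, Nat.coprime_mul_iff_right, Nat.coprime_mul_iff_right,
    Nat.ordProj_mul_ordCompl_eq_self]
  refine and_congr ?_ (by simp)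
  rcases Nat.eq_zero_or_pos (n.factorization 2) with h | h
  · simp [h]
  · rw [Nat.coprime_pow_right_iff h, Nat.coprime_pow_right_iff h]
    simp [Nat.odd_add]

/-- After squaring, the claim is `N (4m - N) ≥ 4` if and only if `N < 4m`. For `N ≥ 4` the second
factor need only be at least `1`; smaller `N` need `m ≥ 2`. -/
theorem natCast_le_two_mul_sqrt_iff {m N : ℕ} (hm : 2 ≤ m) (hN : 0 < N) :
    (N : ℝ) ≤ 2 * √((m * N : ℕ) - 1) ↔ m * N < 4 * m ^ 2 := by
  have e : (2 : ℝ) = √4 := by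
    rw [show (4 : ℝ) = 2 ^ 2 by norm_num, Real.sqrt_sq (by norm_num)]
  rw [e, ← Real.sqrt_mul (by norm_num), Real.le_sqrt' (by positivity),
    show 4 * m ^ 2 = m * (4 * m) by ring, Nat.mul_lt_mul_left (by omega)]
  have h : (N : ℝ) ^ 2 ≤ 4 * ((m * N : ℕ) - 1) ↔ (N : ℤ) ^ 2 ≤ 4 * (m * N - 1) := by
    exact_mod_cast Iff.rfl
  rw [h]
  zify at hm hN ⊢
  constructor
  · intro h
    by_contra! h'
    nlinarith
  · intro h
    rcases lt_or_ge (N : ℤ) 4 with h4 | h4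
    · obtain h' | h' | h' : (N : ℤ) = 1 ∨ (N : ℤ) = 2 ∨ (N : ℤ) = 3 := by omega
      all_goals rw [h']; linarith
    · nlinarith

/-- The number `φ(n) / (q - 1)`, for a prime `q` dividing `n`, is minus an eigenvalue of the sum over
units, and bounds all eigenvalues whose eigenvectors are not periodic. -/
theorem exists_sum_isUnit_eigenvalue {n q : ℕ} [NeZero n]
    [DecidablePred fun x : ZMod n => IsUnit x] (hq : q.Prime) (hqn : q ∣ n) :
    ∃ N : ℕ, n.totient = (q - 1) * N ∧
      (∃ f : ZMod n → ℝ, f ≠ 0 ∧ ∀ x, ∑ y with IsUnit y, f (x + y) = -(N : ℝ) * f x) ∧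
      ∀ (f : ZMod n → ℝ) (μ : ℝ), (∀ x, ∑ y with IsUnit y, f (x + y) = μ * f x) →
        |μ| ≤ N ∨ ∀ x, f (x + (ordCompl[q] n : ℕ)) = f x := by
  classical
  have := Fact.mk hq
  have hcop := Nat.coprime_ordCompl hq (NeZero.ne n)
  have hmul := Nat.ordProj_mul_ordCompl_eq_self n q
  have hdvd := Nat.ordCompl_dvd n q
  have hb := (hq.factorization_pos_of_dvd (NeZero.ne n) hqn).ne'
  generalize ordCompl[q] n = t at *
  have hs := ZMod.exists_castHom_eq hcop hdvd hqn
  have hu := ZMod.isUnit_iff_castHom hmul hb hq hdvd hqn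
  have ht : ZMod.castHom hdvd (ZMod t) (t : ZMod n) = 0 := by rw [map_natCast, ZMod.natCast_self]
  generalize ZMod.castHom hdvd (ZMod t) = π₁ at *
  generalize ZMod.castHom hqn (ZMod q) = π₂ at *
  refine ⟨#{y | IsUnit (π₁ y) ∧ π₂ y = 0}, ?_,
    ⟨fun x => if π₂ x = 0 then (Fintype.card (ZMod q) : ℝ) - 1 else -1, ?_,
      sum_isUnit_residue_indicator π₁ π₂ hs hu⟩,
    fun f μ hf => (abs_le_or_periodic_of_sum_isUnit π₁ π₂ hu hf).imp_right fun h => h _ ht⟩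
  · have h := card_isUnit_eq π₁ π₂ hs hu
    rw [ZMod.card_isUnit, ZMod.card] at h
    zify [hq.one_le]
    exact_mod_cast h
  · intro h0
    -- At `1` the function takes the value `-1`.
    simpa using congrFun h0 1

theorem isRamanujan_unitaryCayleyGraph_zmod_iff {n : ℕ} [NeZero n] (hn : 2 ≤ n) :
    IsRamanujan (unitaryCayleyGraph (ZMod n)) ↔
      ∀ q, q.Prime → Odd q → q ∣ n → n.totient < 4 * (q - 1) ^ 2 := by
  classical
  have : Fact (1 < n) := ⟨hn⟩
  have hφ : 0 < n.totient := Nat.totient_pos.2 (by omega)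
  rw [isRamanujan_unitaryCayleyGraph_iff (ZMod.card_isUnit n)]
  constructor
  · intro hμ q hq hodd hqn
    have h3 := hq.three_le_of_odd hodd
    obtain ⟨N, hc, ⟨f, hf0, hf⟩, -⟩ := exists_sum_isUnit_eigenvalue hq hqn
    have hN0 : 0 < N := Nat.pos_of_ne_zero fun h => by rw [h] at hc; omega
    have hlt : N < n.totient := by
      rw [hc]; exact lt_mul_of_one_lt_left hN0 (by omega)
    have h := hμ (-(N : ℝ)) f hf0 hf ?_ ?_
    · rw [abs_neg, Nat.abs_cast, hc] at h
      rw [hc]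
      exact (natCast_le_two_mul_sqrt_iff (by omega) hN0).1 h
    · have : (0 : ℝ) ≤ n.totient := Nat.cast_nonneg _
      have : (0 : ℝ) < N := Nat.cast_pos.2 hN0
      linarith
    · rw [Ne, neg_inj, Nat.cast_inj]
      exact hlt.ne
  · intro h μ f hf0 hf hne1 hne2
    by_contra hbig
    -- The group of periods of `f`.
    let P : AddSubgroup (ZMod n) :=
      { carrier := {s | ∀ x, f (x + s) = f x}
        zero_mem' := by simp
        add_mem' := fun {a b} ha hb x => by rw [← add_assoc, hb, ha]
        neg_mem' := fun {a} ha x => by rw [← ha (x + -a), neg_add_cancel_right] }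
    have h2 : (2 : ZMod n) ∈ P := by
      refine ZMod.two_mem_of_ordCompl_mem (NeZero.ne n) P ?_ ?_
      · refine (eq_zero_or_periodic_of_sum_isUnit hf ZMod.isUnit_add_two_mul_ordCompl).resolve_left ?_
        rintro rfl
        exact hbig (by rw [abs_zero]; positivity)
      · intro q hq hodd hqn
        obtain ⟨N, hc, -, hper⟩ := exists_sum_isUnit_eigenvalue hq hqn
        have h3 := hq.three_le_of_odd hodd
        refine (hper f μ hf).resolve_left fun hle => hbig (hle.trans ?_)
        have hlt := h q hq hodd hqn
        rw [hc] at hlt ⊢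
        refine (natCast_le_two_mul_sqrt_iff (by omega) (Nat.pos_of_ne_zero fun h0 => ?_)).2 hlt
        rw [h0] at hc; omega
    have := sq_eq_sq_of_periodic_two hf hf0 (fun y hy => by
      obtain ⟨k, hk⟩ := ZMod.exists_eq_one_add_two_mul hy
      refine ⟨_, hk, ?_⟩
      rw [← nsmul_eq_mul]
      exact P.nsmul_mem h2 k) h2
    rw [ZMod.card_isUnit, sq_eq_sq_iff_eq_or_eq_neg] at this
    exact this.elim hne1 hne2

end Spectrum

/-! ### Solving the totient inequality -/

section Arithmetic

theorem four_le_totient_two_pow {a : ℕ} (ha : 3 ≤ a) : 4 ≤ (2 ^ a).totient := by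
  obtain ⟨k, rfl⟩ := Nat.exists_eq_add_of_le' ha
  rw [show k + 3 = (k + 2) + 1 by rfl, Nat.totient_prime_pow_succ Nat.prime_two, pow_add]
  have := Nat.one_le_two_pow (n := k)
  omega

/-- Here `φ(2^a) = 2^(a-1) = 4 · 2^(a-3)`. -/
theorem two_zpow_sub_three_add_one_lt_iff {a p : ℕ} (ha : 1 ≤ a) (hp : 1 ≤ p) :
    (2 : ℝ) ^ ((a : ℤ) - 3) + 1 < (p : ℝ) ↔ (2 ^ a).totient < 4 * (p - 1) := by
  obtain ⟨k, rfl⟩ := Nat.exists_eq_add_of_le' ha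
  obtain ⟨m, rfl⟩ := Nat.exists_eq_add_of_le' hp
  rw [Nat.totient_prime_pow_succ Nat.prime_two, Nat.add_sub_cancel, ← Nat.cast_lt (α := ℝ),
    show ((k + 1 : ℕ) : ℤ) - 3 = (k : ℤ) - 2 by push_cast; ring, zpow_sub₀ two_ne_zero,
    zpow_natCast]
  push_cast
  norm_num
  rw [div_lt_iff₀ (by norm_num), mul_comm]

theorem totient_lt_cases {n : ℕ} (hn : 2 ≤ n)
    (h : ∀ q, q.Prime → Odd q → q ∣ n → n.totient < 4 * (q - 1) ^ 2) :
      (∃ a : ℕ, 1 ≤ a ∧ n = 2 ^ a) ∨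
      (∃ p a : ℕ, p.Prime ∧ Odd p ∧ (a = 1 ∨ a = 2) ∧ n = p ^ a) ∨
      (∃ p q : ℕ, p.Prime ∧ q.Prime ∧ 3 ≤ p ∧ p < q ∧ (q : ℤ) ≤ 2 * (p : ℤ) - 3 ∧
        n = 4 * p * q) ∨
      (∃ p q : ℕ, p.Prime ∧ q.Prime ∧ 3 ≤ p ∧ p < q ∧ (q : ℤ) ≤ 4 * (p : ℤ) - 5 ∧
        (n = p * q ∨ n = 2 * p * q)) ∨
      (∃ p : ℕ, p.Prime ∧ Odd p ∧ (n = 2 * p ^ 2 ∨ n = 4 * p ^ 2)) ∨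
      (∃ p a : ℕ, p.Prime ∧ Odd p ∧ 1 ≤ a ∧ (2 : ℝ) ^ ((a : ℤ) - 3) + 1 < (p : ℝ) ∧
        n = 2 ^ a * p) := by
  obtain ⟨a, k, hk, rfl⟩ := Nat.exists_eq_two_pow_mul_odd (n := n) (by omega)
  rcases eq_or_ne k 1 with rfl | hk1
  · refine Or.inl ⟨a, Nat.pos_of_ne_zero ?_, mul_one _⟩
    rintro rfl
    omega
  right
  have hp := Nat.minFac_prime hk1
  have hpk := Nat.minFac_dvd k
  have hmin : ∀ q, q.Prime → q ∣ k → k.minFac ≤ q := fun q hq hqk =>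
    Nat.minFac_le_of_dvd hq.two_le hqk
  generalize k.minFac = p at *
  have hpo : Odd p := hk.of_dvd_nat hpk
  have hp3 := hp.three_le_of_odd hpo
  have hlt := h p hp hpo (hpk.mul_left _)
  clear h
  obtain ⟨b, m, hpm, rfl⟩ := Nat.exists_eq_pow_mul_and_not_dvd (n := k)
    (by rintro rfl; simp at hk) p hp.ne_one
  obtain _ | b := b
  · exact absurd (by simpa using hpk) hpm
  have hmo : Odd m := hk.of_dvd_nat (Dvd.intro_left _ rfl)
  rw [Nat.totient_mul ((Nat.coprime_two_left.2 hk).pow_left a),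
    Nat.totient_mul (((hp.coprime_iff_not_dvd).2 hpm).pow_left _),
    Nat.totient_prime_pow_succ hp] at hlt
  set A := (2 ^ a).totient with hA
  have hA0 : 1 ≤ A := Nat.totient_pos.2 (by positivity)
  have ha3 : A < 4 → a = 0 ∨ a = 1 ∨ a = 2 := by
    intro h4
    by_contra! h'
    exact absurd (four_le_totient_two_pow (a := a) (by omega)) (by omega)
  -- With `n = 2^a p^(b+1) m`, cancelling `p - 1` gives the inequality that drives all the cases.
  replace hlt : A * p ^ b * m.totient < 4 * (p - 1) := by
    refine Nat.lt_of_mul_lt_mul_right (a := p - 1) ?_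
    calc _ = A * (p ^ b * (p - 1) * m.totient) := by ring
      _ < _ := hlt
      _ = _ := by ring
  rcases eq_or_ne m 1 with rfl | hm1
  · rw [Nat.totient_one, mul_one] at hlt
    obtain _ | _ | b := b
    · rw [pow_zero, mul_one] at hlt
      rcases Nat.eq_zero_or_pos a with rfl | ha
      · exact Or.inl ⟨p, 1, hp, hpo, by simp, by simp⟩
      · refine Or.inr <| Or.inr <| Or.inr <| Or.inr ⟨p, a, hp, hpo, ha,
          (two_zpow_sub_three_add_one_lt_iff ha hp.one_le).2 hlt, by simp⟩
    · have hA4 : A < 4 := by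
        by_contra! h4
        have : 4 * p ≤ A * p := Nat.mul_le_mul_right p h4
        rw [zero_add, pow_one] at hlt
        omega
      obtain rfl | rfl | rfl := ha3 hA4
      · exact Or.inl ⟨p, 2, hp, hpo, by simp, by simp⟩
      · exact Or.inr <| Or.inr <| Or.inr <| Or.inl ⟨p, hp, hpo, Or.inl (by simp)⟩
      · exact Or.inr <| Or.inr <| Or.inr <| Or.inl ⟨p, hp, hpo, Or.inr (by simp)⟩
    · exfalso
      have h1 : p ^ 2 ≤ p ^ (b + 1 + 1) := Nat.pow_le_pow_right hp.pos (by omega)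
      have h2 : p ^ 2 ≤ A * p ^ (b + 1 + 1) := h1.trans (Nat.le_mul_of_pos_left _ hA0)
      zify [hp.one_le] at hlt h2
      nlinarith [sq_nonneg ((p : ℤ) - 2)]
  · have hq := Nat.minFac_prime hm1
    have hqm := Nat.minFac_dvd m
    have hqmin : ∀ r, r.Prime → r ∣ m → m.minFac ≤ r := fun r hr hrm =>
      Nat.minFac_le_of_dvd hr.two_le hrm
    generalize m.minFac = q at *
    have hqo : Odd q := hmo.of_dvd_nat hqm
    -- Both primes are odd, so they differ by at least `2`; hence `q - 1 ≥ 4`, which rules out any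
    -- further odd prime factor and any square of `p` or `q`.
    have hpq : p + 2 ≤ q := by
      have h1 := hmin q hq (hqm.mul_left _)
      have h2 : p ≠ q := by rintro rfl; exact hpm hqm
      obtain ⟨i, rfl⟩ := hpo
      obtain ⟨j, rfl⟩ := hqo
      omega
    have hφm : ∀ x, x ≠ 0 → q ∣ x → q - 1 ≤ x.totient := fun x hx hqx => by
      rw [← Nat.totient_prime hq]
      exact Nat.le_of_dvd (Nat.totient_pos.2 (Nat.pos_of_ne_zero hx)) (Nat.totient_dvd_of_dvd hqx)
    have hm0 : m ≠ 0 := by rintro rfl; simp at hpm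
    obtain _ | b := b
    · rw [pow_zero, mul_one] at hlt
      obtain ⟨m, rfl⟩ := hqm
      have hm0' : m ≠ 0 := right_ne_zero_of_mul hm0
      by_cases hqm' : q ∣ m
      · exfalso
        have h1 := hφm m hm0' hqm'
        rw [Nat.totient_mul_of_prime_of_dvd hq hqm'] at hlt
        have h2 : q * (q - 1) ≤ A * (q * m.totient) :=
          (Nat.mul_le_mul_left q h1).trans (Nat.le_mul_of_pos_left _ hA0)
        have h3 : 4 * (q - 1) ≤ q * (q - 1) := Nat.mul_le_mul_right _ (by omega)
        omega
      · rw [Nat.totient_mul_of_prime_of_not_dvd hq hqm'] at hlt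
        rcases eq_or_ne m 1 with rfl | hm1'
        · rw [Nat.totient_one, mul_one] at hlt
          have hA4 : A < 4 := by
            by_contra! h4
            have : 4 * (q - 1) ≤ A * (q - 1) := Nat.mul_le_mul_right _ h4
            omega
          -- Parity sharpens `q ≤ 4p - 4` to `4p - 5`, and `q ≤ 2p - 2` to `2p - 3`.
          obtain ⟨i, rfl⟩ := hpo
          obtain ⟨j, rfl⟩ := hqo
          obtain rfl | rfl | rfl := ha3 hA4
          · refine Or.inr <| Or.inr <| Or.inl ⟨_, _, hp, hq, hp3, by omega, ?_, Or.inl (by simp)⟩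
            simp [hA] at hlt
            omega
          · refine Or.inr <| Or.inr <| Or.inl
              ⟨_, _, hp, hq, hp3, by omega, ?_, Or.inr (by simp [mul_assoc])⟩
            simp [hA] at hlt
            omega
          · refine Or.inr <| Or.inl ⟨_, _, hp, hq, hp3, by omega, ?_, by simp [mul_assoc]⟩
            rw [hA, Nat.totient_prime_pow_succ Nat.prime_two] at hlt
            omega
        · exfalso
          have h1 : q ≤ m.minFac :=
            hqmin _ (Nat.minFac_prime hm1') ((Nat.minFac_dvd m).mul_left _)
          have h2 : m.minFac - 1 ≤ m.totient := by
            rw [← Nat.totient_prime (Nat.minFac_prime hm1')]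
            exact Nat.le_of_dvd (Nat.totient_pos.2 (Nat.pos_of_ne_zero hm0'))
              (Nat.totient_dvd_of_dvd (Nat.minFac_dvd m))
          have h3 : (q - 1) * 4 ≤ A * ((q - 1) * m.totient) :=
            (Nat.mul_le_mul_left _ (by omega)).trans (Nat.le_mul_of_pos_left _ hA0)
          omega
    · exfalso
      have h1 : p ≤ p ^ (b + 1) := Nat.le_self_pow (by omega) p
      have h2 : p * (q - 1) ≤ A * p ^ (b + 1) * m.totient :=
        Nat.mul_le_mul (h1.trans (Nat.le_mul_of_pos_left _ hA0)) (hφm m hm0 hqm)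
      have h3 : p * 4 ≤ p * (q - 1) := Nat.mul_le_mul_left _ (by omega)
      omega

theorem totient_lt_of_two_pow_mul_pow {a b p : ℕ} (hp : p.Prime) (hpo : Odd p)
    (hlt : (2 ^ a).totient * p ^ b < 4 * (p - 1)) {r : ℕ} (hr : r.Prime) (ho : Odd r)
    (hrn : r ∣ 2 ^ a * p ^ (b + 1)) : (2 ^ a * p ^ (b + 1)).totient < 4 * (r - 1) ^ 2 := by
  have h1 := ((Nat.coprime_two_right.2 ho).pow_right a).dvd_of_dvd_mul_left hrn
  obtain rfl := (Nat.prime_dvd_prime_iff_eq hr hp).1 (hr.dvd_of_dvd_pow h1)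
  rw [Nat.totient_mul ((Nat.coprime_two_left.2 hpo).pow _ _), Nat.totient_prime_pow_succ hp,
    ← mul_assoc, sq, ← mul_assoc]
  exact Nat.mul_lt_mul_of_pos_right hlt (by have := hp.two_le; omega)

/-- The right side grows with `r`, so the case `r = p` suffices; there `hlt` is multiplied by `p -
1`. -/
theorem totient_lt_of_two_pow_mul_mul {a p q : ℕ} (hp : p.Prime) (hq : q.Prime) (hp3 : 3 ≤ p)
    (hpq : p < q) (hlt : (2 ^ a).totient * (q - 1) < 4 * (p - 1)) {r : ℕ} (hr : r.Prime)
    (ho : Odd r) (hrn : r ∣ 2 ^ a * (p * q)) :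
    (2 ^ a * (p * q)).totient < 4 * (r - 1) ^ 2 := by
  have h1 := ((Nat.coprime_two_right.2 ho).pow_right a).dvd_of_dvd_mul_left hrn
  have hpr : p - 1 ≤ r - 1 := by
    rcases hr.dvd_mul.1 h1 with h | h
    · rw [(Nat.prime_dvd_prime_iff_eq hr hp).1 h]
    · rw [(Nat.prime_dvd_prime_iff_eq hr hq).1 h]; omega
  have hpo : Odd p := hp.odd_of_ne_two (by omega)
  have hqo : Odd q := hq.odd_of_ne_two (by omega)
  refine lt_of_lt_of_le ?_ (Nat.mul_le_mul_left 4 (Nat.pow_le_pow_left hpr 2))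
  rw [Nat.totient_mul ((Nat.coprime_two_left.2 (hpo.mul hqo)).pow_left _),
    Nat.totient_mul ((Nat.coprime_primes hp hq).2 hpq.ne), Nat.totient_prime hp,
    Nat.totient_prime hq, mul_comm (p - 1), ← mul_assoc, sq, ← mul_assoc]
  exact Nat.mul_lt_mul_of_pos_right hlt (by omega)

end Arithmetic

theorem corollary3p4 (n : ℕ) [NeZero n] (hn : 2 ≤ n) :
    IsRamanujan (unitaryCayleyGraph (ZMod n)) ↔
      -- (a)
      (∃ a : ℕ, 1 ≤ a ∧ n = 2 ^ a) ∨
      -- (b)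
      (∃ p a : ℕ, p.Prime ∧ Odd p ∧ (a = 1 ∨ a = 2) ∧ n = p ^ a) ∨
      -- (c)
      (∃ p q : ℕ, p.Prime ∧ q.Prime ∧ 3 ≤ p ∧ p < q ∧ (q : ℤ) ≤ 2 * (p : ℤ) - 3 ∧
        n = 4 * p * q) ∨
      -- (d)
      (∃ p q : ℕ, p.Prime ∧ q.Prime ∧ 3 ≤ p ∧ p < q ∧ (q : ℤ) ≤ 4 * (p : ℤ) - 5 ∧
        (n = p * q ∨ n = 2 * p * q)) ∨
      -- (e)
      (∃ p : ℕ, p.Prime ∧ Odd p ∧ (n = 2 * p ^ 2 ∨ n = 4 * p ^ 2)) ∨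
      (∃ p a : ℕ, p.Prime ∧ Odd p ∧ 1 ≤ a ∧ (2 : ℝ) ^ ((a : ℤ) - 3) + 1 < (p : ℝ) ∧
        n = 2 ^ a * p) := by
  rw [isRamanujan_unitaryCayleyGraph_zmod_iff hn]
  refine ⟨totient_lt_cases hn, ?_⟩
  have φ4 : (2 ^ 2).totient = 2 := Nat.totient_prime_pow_succ Nat.prime_two 1
  rintro (⟨a, -, rfl⟩ | ⟨p, a, hp, ho, rfl | rfl, rfl⟩ | ⟨p, q, hp, hq, hp3, hpq, hle, rfl⟩ |
    ⟨p, q, hp, hq, hp3, hpq, hle, rfl | rfl⟩ | ⟨p, hp, ho, rfl | rfl⟩ |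
    ⟨p, a, hp, ho, ha, hlt, rfl⟩) r hr hro hrn
  · rw [(Nat.prime_dvd_prime_iff_eq hr Nat.prime_two).1 (hr.dvd_of_dvd_pow hrn)] at hro
    exact absurd hro (by decide)
  · have h3 := hp.three_le_of_odd ho
    rw [← one_mul (p ^ 1)] at hrn ⊢
    exact totient_lt_of_two_pow_mul_pow (a := 0) (b := 0) hp ho (by simp; omega) hr hro hrn
  · have h3 := hp.three_le_of_odd ho
    rw [← one_mul (p ^ 2)] at hrn ⊢
    exact totient_lt_of_two_pow_mul_pow (a := 0) (b := 1) hp ho (by simp; omega) hr hro hrn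
  · rw [mul_assoc] at hrn ⊢
    exact totient_lt_of_two_pow_mul_mul (a := 2) hp hq hp3 hpq (by rw [φ4]; omega) hr hro hrn
  · rw [← one_mul (p * q)] at hrn ⊢
    exact totient_lt_of_two_pow_mul_mul (a := 0) hp hq hp3 hpq (by simp; omega) hr hro hrn
  · rw [mul_assoc] at hrn ⊢
    exact totient_lt_of_two_pow_mul_mul (a := 1) hp hq hp3 hpq (by simp; omega) hr hro hrn
  · have h3 := hp.three_le_of_odd ho
    exact totient_lt_of_two_pow_mul_pow (a := 1) (b := 1) hp ho (by simp; omega) hr hro hrn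
  · have h3 := hp.three_le_of_odd ho
    exact totient_lt_of_two_pow_mul_pow (a := 2) (b := 1) hp ho
      (by rw [φ4, pow_one]; omega) hr hro hrn
  · rw [← pow_one p] at hrn ⊢
    exact totient_lt_of_two_pow_mul_pow (b := 0) hp ho
      (by rw [pow_zero, mul_one]; exact (two_zpow_sub_three_add_one_lt_iff ha hp.one_le).1 hlt)
      hr hro hrn
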